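/- Let $C=\mathbb C[x,y]$ and let $\mathbb Z^2$ act on $C$ by letting $(i,j)$ act as $\sigma^i\tau^j$, where $\sigma,\tau$ are the $\mathbb C$-algebra automorphisms with $\sigma(x)=x+1$, $\sigma(y)=y$, $\tau(x)=x$, $\tau(y)=y+1$. Let $B=C\#\mathbb Z^2$ be the skew group ring, that is, the free left $C$-module on the elements of $\mathbb Z^2$ with multiplication $(rh)(sg)=(r\,h(s))(hg)$. For an ideal $I$ of $C$ let $IB$ be the right ideal of $B$ generated by $I$, and let $\mathbb I_B(IB)=\{b\in B: b\,IB\subseteq IB\}$ be its idealiser. Suppose that $I$ is a maximal ideal of $C$. Then $\mathbb I_B(IB)$ is right noetherian but not left noetherian. Moreover, $V(I)=\{p\}$ for a point $p=(p_1,p_2)\in\mathbb C^2$. Let $\mathbb Z^2$ act on $\mathbb C^2$ by $(i,j)\cdot q=q+(i,j)$. Then all the points $p+(0,j)$ with $j\in\mathbb Z$ lie on the vertical line $V(x-p_1)$, so the orbit $\mathbb Z^2\cdot p$ meets this line in infinitely many points, and therefore the orbit is not critically dense in $\mathbb C^2$. Here an infinite subset $S$ of an affine variety $X$ is called critically dense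 if $S\cap Y$ is finite for every proper Zariski closed subset $Y$ of $X$. -/

import Mathlib

noncomputable section

namespace IdealiserExample

/-- The idealiser `{b ∈ B | b J ⊆ J}` of a right ideal `J` of a ring `B`, as a subring of `B`.
Right ideals are submodules of `B` over the opposite ring. -/
def idealiser {B : Type*} [Ring B] (J : Submodule Bᵐᵒᵖ B) : Subring B where
  carrier := {b | ∀ x ∈ J, b * x ∈ J}
  mul_mem' := fun {a b} ha hb x hx => by
    rw [mul_assoc]
    exact ha _ (hb x hx)
  one_mem' := fun x hx => by rwa [one_mul]
  add_mem' := fun {a b} ha hb x hx => by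
    rw [add_mul]
    exact J.add_mem (ha x hx) (hb x hx)
  zero_mem' := fun x _ => by
    rw [zero_mul]
    exact J.zero_mem
  neg_mem' := fun {a} ha x hx => by
    rw [neg_mul]
    exact J.neg_mem (ha x hx)

/-- The right ideal `I B` of the skew group ring `B = A # G` that is generated by an ideal `I`
of `A`. Here `A # G` is `SkewMonoidAlgebra A G`, with `(r h) (s g) = (r (h • s)) (h g)`, and
`r ∈ A` is identified with `r 1_G ∈ B`. -/
def extendedRightIdeal {A : Type*} [CommRing A] (G : Type*) [Group G] [MulSemiringAction G A]
    (I : Ideal A) : Submodule (SkewMonoidAlgebra A G)ᵐᵒᵖ (SkewMonoidAlgebra A G) :=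
  Submodule.span (SkewMonoidAlgebra A G)ᵐᵒᵖ
    ((fun r : A => SkewMonoidAlgebra.single (1 : G) r) '' (I : Set A))

/-- A subset `S` of an affine variety `X ⊆ kⁿ` is critically dense if it is infinite and meets
every proper Zariski closed subset `X ∩ V(J)` of `X` in a finite set. -/
def IsCriticallyDense {k : Type*} [Field k] {n : ℕ} (X S : Set (Fin n → k)) : Prop :=
  S ⊆ X ∧ S.Infinite ∧ ∀ J : Ideal (MvPolynomial (Fin n) k),
    ¬ X ⊆ MvPolynomial.zeroLocus k J → (S ∩ (X ∩ MvPolynomial.zeroLocus k J)).Finite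

/-- The polynomial ring `ℂ[x, y]`, with `x = X 0` and `y = X 1`. -/
abbrev Poly : Type := MvPolynomial (Fin 2) ℂ

/-- The group `ℤ²`, written multiplicatively. -/
abbrev Lattice : Type := Multiplicative (ℤ × ℤ)

/-- The substitution `x ↦ x + a`, `y ↦ y + b` on `ℂ[x, y]`. -/
def shiftHom (a b : ℂ) : Poly →ₐ[ℂ] Poly :=
  MvPolynomial.aeval ![MvPolynomial.X 0 + MvPolynomial.C a, MvPolynomial.X 1 + MvPolynomial.C b]

theorem shiftHom_comp (a b c d : ℂ) :
    (shiftHom a b).comp (shiftHom c d) = shiftHom (a + c) (b + d) := by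
  apply MvPolynomial.algHom_ext
  intro i
  fin_cases i <;> simp [shiftHom, MvPolynomial.algHom_C, add_assoc]

theorem shiftHom_zero : shiftHom 0 0 = AlgHom.id ℂ Poly := by
  apply MvPolynomial.algHom_ext
  intro i
  fin_cases i <;> simp [shiftHom]

/-- The substitution `x ↦ x + a`, `y ↦ y + b` as an automorphism of `ℂ[x, y]`. -/
def shift (a b : ℂ) : Poly ≃ₐ[ℂ] Poly :=
  AlgEquiv.ofAlgHom (shiftHom a b) (shiftHom (-a) (-b))
    (by rw [shiftHom_comp, add_neg_cancel, add_neg_cancel, shiftHom_zero])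
    (by rw [shiftHom_comp, neg_add_cancel, neg_add_cancel, shiftHom_zero])

/-- `σ(x) = x + 1`, `σ(y) = y`. -/
def sigma : Poly ≃ₐ[ℂ] Poly := shift 1 0

/-- `τ(x) = x`, `τ(y) = y + 1`. -/
def tau : Poly ≃ₐ[ℂ] Poly := shift 0 1

theorem sigma_commute_tau : Commute sigma tau := by
  apply AlgEquiv.ext
  intro f
  have h : (shiftHom 1 0).comp (shiftHom 0 1) = (shiftHom 0 1).comp (shiftHom 1 0) := by
    rw [shiftHom_comp, shiftHom_comp, add_comm (1 : ℂ), add_comm (0 : ℂ) 1]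
  exact DFunLike.congr_fun h f

/-- The homomorphism from `ℤ²` to the automorphisms of `ℂ[x, y]`, `(i, j) ↦ σ^i τ^j`. -/
def latticeHom : Lattice →* (Poly ≃ₐ[ℂ] Poly) where
  toFun g := sigma ^ (Multiplicative.toAdd g).1 * tau ^ (Multiplicative.toAdd g).2
  map_one' := by simp
  map_mul' g h := by
    have hc := (sigma_commute_tau.zpow_zpow (Multiplicative.toAdd h).1
      (Multiplicative.toAdd g).2).eq
    rw [toAdd_mul, Prod.fst_add, Prod.snd_add, zpow_add, zpow_add, mul_assoc, mul_assoc,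
      ← mul_assoc (sigma ^ (Multiplicative.toAdd h).1), hc, mul_assoc]

/-- `ℤ²` acts on `ℂ[x, y]` by translation: `(i, j)` acts as `σ^i τ^j`. -/
instance latticeAction : MulSemiringAction Lattice Poly :=
  MulSemiringAction.compHom Poly latticeHom

theorem lattice_smul_def (g : Lattice) (f : Poly) :
    g • f = (sigma ^ (Multiplicative.toAdd g).1 * tau ^ (Multiplicative.toAdd g).2) f := rfl

/-- The skew group ring `B = ℂ[x, y] # ℤ²`. -/
abbrev SkewRing : Type := SkewMonoidAlgebra Poly Lattice

/-- The idealiser `{b ∈ B | b (I B) ⊆ I B}` for an ideal `I` of `ℂ[x, y]`. -/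
abbrev idealiserAt (I : Ideal Poly) : Subring SkewRing :=
  idealiser (extendedRightIdeal Lattice I)

/-- The action of `ℤ²` on the plane: `(i, j)` sends `p` to `p + (i, j)`. -/
def translatePoint (g : ℤ × ℤ) (p : Fin 2 → ℂ) : Fin 2 → ℂ :=
  ![p 0 + g.1, p 1 + g.2]

/-- The orbit `ℤ² · p = p + ℤ²`. -/
def pointOrbit (p : Fin 2 → ℂ) : Set (Fin 2 → ℂ) :=
  Set.range (fun g : ℤ × ℤ => translatePoint g p)

/-- The vertical line `V(x - c)` in the plane. -/
def verticalLine (c : ℂ) : Set (Fin 2 → ℂ) :=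
  MvPolynomial.zeroLocus ℂ (Ideal.span {(MvPolynomial.X 0 - MvPolynomial.C c : Poly)})

end IdealiserExample

end

/-! By the Nullstellensatz `I` is the ideal of a point `p`. The action on the orbit of `p` is free,
so polynomials separate its points, and `b` lies in the idealiser `R` exactly when all its
coefficients away from the identity vanish at `p` (`mem_idealiserAt`).

Right side: `B` is right noetherian by a Hilbert basis argument with leading coefficients on the
quadrant. Interpolation on the orbit shows that the only right `R`-submodules of `B / IB` are `0`,
`R / IB` and `B / IB`. As `IB ⊆ R`, `isNoetherianRing_of_quotient` brings the chain condition from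
`B` down to `R`.

Left side: `f = x - p₁` is fixed by vertical translations. If finitely many `f τ^i` generated
another `f τ^j` over `R`, comparing coefficients at `τ^j` would give `f ∈ I f`, hence `1 ∈ I`. The
same vertical line meets the orbit infinitely often, so critical density fails. -/

namespace IdealiserExample

/-! ### Hilbert's basis theorem for skew group rings of `ℤ²` -/

/-- Monotone maps from a well quasi-order to an order with the ascending chain condition satisfy
the ascending chain condition. -/
theorem wellFoundedGT_orderHom {P α : Type*} [Preorder P] [WellQuasiOrderedLE P] [PartialOrder α]
    [WellFoundedGT α] : WellFoundedGT (P →o α) := by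
  refine ⟨RelEmbedding.wellFounded_iff_isEmpty.2 ⟨fun F => ?_⟩⟩
  have hF : StrictMono (F : ℕ → P →o α) := fun a b h => F.map_rel_iff.2 h
  have hn : ∀ k, ∃ n, F k n < F (k + 1) n := by
    intro k
    obtain ⟨hle, hne⟩ := lt_iff_le_and_ne.1 (hF k.lt_succ_self)
    by_contra! h
    exact hne (OrderHom.ext _ _ (funext fun n => (hle n).eq_of_not_lt (h n)))
  choose n hn using hn
  obtain ⟨g, hg⟩ := (wellQuasiOrdered_le (α := P)).exists_monotone_subseq n
  -- Along a subsequence on which the points of strict increase are themselves monotone, the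
  -- diagonal values form a strict chain.
  have hs : StrictMono fun i => F (g i) (n (g i)) := by
    refine strictMono_nat_of_lt_succ fun i => ?_
    calc F (g i) (n (g i)) < F (g i + 1) (n (g i)) := hn _
      _ ≤ F (g (i + 1)) (n (g i)) := hF.monotone (Nat.succ_le_of_lt (g.strictMono i.lt_succ_self)) _
      _ ≤ F (g (i + 1)) (n (g (i + 1))) := (F _).monotone (hg _ _ i.le_succ)
  exact (RelEmbedding.wellFounded_iff_isEmpty.1 (wellFounded_gt (α := α))).elim
    (RelEmbedding.ofMonotone (fun i => F (g i) (n (g i))) fun _ _ h => hs h)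

section SkewGroupRing

variable {A G : Type*} [CommRing A] [Group G] [MulSemiringAction G A]

theorem coeff_mul_single (f : SkewMonoidAlgebra A G) (x : G) (r : A) (z : G) :
    (f * SkewMonoidAlgebra.single x r).coeff z = f.coeff (z * x⁻¹) * (z * x⁻¹) • r :=
  SkewMonoidAlgebra.coeff_mul_single_aux f fun a => by rw [eq_mul_inv_iff_mul_eq]

theorem mul_mem_right {J : Submodule (SkewMonoidAlgebra A G)ᵐᵒᵖ (SkewMonoidAlgebra A G)}
    {b : SkewMonoidAlgebra A G} (hb : b ∈ J) (c : SkewMonoidAlgebra A G) : b * c ∈ J :=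
  J.smul_mem (MulOpposite.op c) hb

end SkewGroupRing

/-- The elements of `ℤ²` with nonnegative coordinates. -/
def quadrant (n : ℕ × ℕ) : Lattice := Multiplicative.ofAdd ((n.1 : ℤ), (n.2 : ℤ))

theorem quadrant_add (m n : ℕ × ℕ) : quadrant (m + n) = quadrant m * quadrant n := by
  simp [quadrant, ← ofAdd_add]

theorem exists_mul_quadrant (s : Finset Lattice) :
    ∃ k, ∀ g ∈ s, ∃ m, g * quadrant k = quadrant m := by
  classical
  induction s using Finset.induction_on with
  | empty => simp
  | insert a s _ ih =>
    obtain ⟨k, hk⟩ := ih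
    let l : ℕ × ℕ := (a.toAdd.1.natAbs, a.toAdd.2.natAbs)
    obtain ⟨q, hq⟩ : ∃ q, a * quadrant l = quadrant q := by
      refine ⟨((a.toAdd.1 + l.1).toNat, (a.toAdd.2 + l.2).toNat), ?_⟩
      have h1 := neg_abs_le a.toAdd.1
      have h2 := neg_abs_le a.toAdd.2
      apply Multiplicative.toAdd.injective
      ext <;> simp [quadrant, l] <;> omega
    refine ⟨k + l, fun g hg => ?_⟩
    rcases Finset.mem_insert.1 hg with rfl | hg
    · exact ⟨q + k, by rw [add_comm k, quadrant_add, ← mul_assoc, hq, quadrant_add]⟩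
    · obtain ⟨m, hm⟩ := hk g hg
      exact ⟨m + l, by rw [quadrant_add, ← mul_assoc, hm, quadrant_add]⟩

section HilbertBasis

variable {A : Type*} [CommRing A]

/-- The support of `f` consists of points of the quadrant that are at most `n` in the
lexicographic order. -/
def SupportLE (f : SkewMonoidAlgebra A Lattice) (n : ℕ × ℕ) : Prop :=
  ∀ g, f.coeff g ≠ 0 → ∃ m, g = quadrant m ∧ toLex m ≤ toLex n

theorem SupportLE.add {f g : SkewMonoidAlgebra A Lattice} {n : ℕ × ℕ} (hf : SupportLE f n)
    (hg : SupportLE g n) : SupportLE (f + g) n := by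
  intro x hx
  by_cases h : f.coeff x = 0
  · exact hg x fun h' => hx (by simp [h, h'])
  · exact hf x h

theorem SupportLE.neg {f : SkewMonoidAlgebra A Lattice} {n : ℕ × ℕ} (hf : SupportLE f n) :
    SupportLE (-f) n := fun x hx => hf x (by simpa using hx)

variable [MulSemiringAction Lattice A]

/-- The ideal of leading coefficients at the exponent `n` of a right ideal of `A # ℤ²`. -/
def leadingIdeal (J : Submodule (SkewMonoidAlgebra A Lattice)ᵐᵒᵖ (SkewMonoidAlgebra A Lattice))
    (n : ℕ × ℕ) : Ideal A where
  carrier := {c | ∃ f ∈ J, SupportLE f n ∧ f.coeff (quadrant n) = c}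
  zero_mem' := ⟨0, J.zero_mem, fun g hg => absurd (by simp) hg, by simp⟩
  add_mem' := by
    rintro _ _ ⟨f, hf, hfn, rfl⟩ ⟨g, hg, hgn, rfl⟩
    exact ⟨f + g, J.add_mem hf hg, hfn.add hgn, by simp⟩
  smul_mem' := by
    rintro r _ ⟨f, hf, hfn, rfl⟩
    -- Moving past `quadrant n` twists scalars by its action; the inverse twist cancels this.
    refine ⟨f * SkewMonoidAlgebra.single 1 ((quadrant n)⁻¹ • r), mul_mem_right hf _, ?_, ?_⟩
    · intro g hg
      rw [coeff_mul_single, inv_one, mul_one] at hg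
      exact hfn g (left_ne_zero_of_mul hg)
    · rw [coeff_mul_single, inv_one, mul_one, smul_inv_smul, mul_comm, smul_eq_mul]

/-- Right multiplication by a group element translates the support and leaves the coefficients
unchanged. -/
theorem leadingIdeal_monotone
    (J : Submodule (SkewMonoidAlgebra A Lattice)ᵐᵒᵖ (SkewMonoidAlgebra A Lattice)) :
    Monotone (leadingIdeal J) := by
  intro n n' h
  obtain ⟨k, rfl⟩ := exists_add_of_le h
  rintro _ ⟨f, hf, hfn, rfl⟩
  refine ⟨f * SkewMonoidAlgebra.single (quadrant k) 1, mul_mem_right hf _, ?_, ?_⟩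
  · intro g hg
    rw [coeff_mul_single] at hg
    obtain ⟨m, hm, hmn⟩ := hfn _ (left_ne_zero_of_mul hg)
    refine ⟨m + k, by rw [quadrant_add, ← hm, inv_mul_cancel_right], ?_⟩
    rw [toLex_add, toLex_add]
    exact add_le_add_left hmn _
  · rw [coeff_mul_single, quadrant_add, mul_inv_cancel_right, smul_one, mul_one]

theorem leadingIdeal_mono_left
    {J J' : Submodule (SkewMonoidAlgebra A Lattice)ᵐᵒᵖ (SkewMonoidAlgebra A Lattice)}
    (h : J ≤ J') (n : ℕ × ℕ) : leadingIdeal J n ≤ leadingIdeal J' n := by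
  rintro _ ⟨f, hf, hfn, rfl⟩
  exact ⟨f, h hf, hfn, rfl⟩

/-- Well-founded lexicographic induction: subtracting an element of `J` with the same leading
coefficient strictly lowers the top exponent. -/
theorem mem_of_supportLE
    {J J' : Submodule (SkewMonoidAlgebra A Lattice)ᵐᵒᵖ (SkewMonoidAlgebra A Lattice)}
    (h : J ≤ J') (hL : ∀ n, leadingIdeal J' n ≤ leadingIdeal J n) (n : ℕ ×ₗ ℕ) :
    ∀ f ∈ J', SupportLE f (ofLex n) → f ∈ J := by
  classical
  induction n using WellFoundedLT.induction with
  | ind n ih =>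
    intro f hf hfn
    obtain ⟨f', hf', hfn', hc⟩ := hL (ofLex n) ⟨f, hf, hfn, rfl⟩
    have hd : SupportLE (f - f') (ofLex n) := by
      rw [sub_eq_add_neg]
      exact hfn.add hfn'.neg
    have h0 : (f - f').coeff (quadrant (ofLex n)) = 0 := by simp [hc]
    suffices f - f' ∈ J by simpa using J.add_mem this hf'
    by_cases hz : f - f' = 0
    · rw [hz]
      exact J.zero_mem
    have hdJ : f - f' ∈ J' := J'.sub_mem hf (h hf')
    generalize f - f' = d at *
    choose! m hm hmn using hd
    have hne : (d.support).Nonempty := by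
      rw [Finset.nonempty_iff_ne_empty, Ne, SkewMonoidAlgebra.support_eq_empty]
      exact hz
    obtain ⟨g, hg, hmax⟩ := d.support.exists_max_image (fun g => toLex (m g)) hne
    rw [SkewMonoidAlgebra.mem_support_iff] at hg
    refine ih (toLex (m g)) (lt_of_le_of_ne (hmn g hg) ?_) d hdJ fun g' hg' =>
      ⟨m g', hm g' hg', hmax g' (SkewMonoidAlgebra.mem_support_iff.2 hg')⟩
    rintro heq
    apply hg
    rw [hm g hg, ← h0, ← heq]
    rfl

/-- Group elements are units, so the support may be translated into the quadrant, and back once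
membership is known. -/
theorem le_of_leadingIdeal_le
    {J J' : Submodule (SkewMonoidAlgebra A Lattice)ᵐᵒᵖ (SkewMonoidAlgebra A Lattice)}
    (h : J ≤ J') (hL : ∀ n, leadingIdeal J' n ≤ leadingIdeal J n) : J' ≤ J := by
  intro f hf
  obtain ⟨k, hk⟩ := exists_mul_quadrant f.support
  choose! m hm using hk
  have hmem : f * SkewMonoidAlgebra.single (quadrant k) 1 ∈ J := by
    refine mem_of_supportLE h hL (f.support.sup fun g => toLex (m g)) _ (mul_mem_right hf _) ?_
    intro g hg
    rw [coeff_mul_single] at hg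
    have hg' := SkewMonoidAlgebra.mem_support_iff.2 (left_ne_zero_of_mul hg)
    refine ⟨m (g * (quadrant k)⁻¹), by rw [← hm _ hg', inv_mul_cancel_right], ?_⟩
    exact Finset.le_sup (f := fun g => toLex (m g)) hg'
  have := mul_mem_right hmem (SkewMonoidAlgebra.single (quadrant k)⁻¹ 1)
  rwa [mul_assoc, SkewMonoidAlgebra.single_mul_single, mul_inv_cancel, smul_one, mul_one,
    ← SkewMonoidAlgebra.one_def, mul_one] at this

/-- Hilbert's basis theorem for the skew group ring `A # ℤ²`. -/
theorem isNoetherian_skewMonoidAlgebra [IsNoetherianRing A] :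
    IsNoetherian (SkewMonoidAlgebra A Lattice)ᵐᵒᵖ (SkewMonoidAlgebra A Lattice) := by
  rw [isNoetherian_iff']
  have := wellFoundedGT_orderHom (P := ℕ × ℕ) (α := Ideal A)
  let L : Submodule (SkewMonoidAlgebra A Lattice)ᵐᵒᵖ (SkewMonoidAlgebra A Lattice) →
      (ℕ × ℕ →o Ideal A) := fun J => ⟨leadingIdeal J, leadingIdeal_monotone J⟩
  have hL : StrictMono L := fun J J' h => lt_of_le_not_ge
    (fun n => leadingIdeal_mono_left h.le n) fun h' => h.not_ge (le_of_leadingIdeal_le h.le h')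
  exact hL.wellFoundedGT

end HilbertBasis

/-! ### Descent of the noetherian property to a subring -/

/-- Let `R` be a subring of a noetherian ring `S` and let `L ⊆ R` be an `R`-submodule of `S` such
that `S / L` is noetherian over `R`. Then `R` is noetherian. -/
theorem isNoetherianRing_of_quotient {S : Type*} [Ring S] (R : Subring S) [IsNoetherianRing S]
    (L : Submodule R S) (hL : ∀ l ∈ L, l ∈ R) [IsNoetherian R (S ⧸ L)] : IsNoetherianRing R := by
  classical
  refine ⟨fun K => ?_⟩
  let ι : R →ₗ[R] S := LinearMap.toSpanSingleton R S 1
  have hι : ∀ r : R, ι r = r := fun r => by simp [ι, Subring.smul_def]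
  refine Submodule.fg_of_fg_map_injective ι (fun a b h => Subtype.ext (by rwa [hι, hι] at h)) ?_
  set N := K.map ι
  obtain ⟨T, hTN, hT⟩ := (Submodule.fg_span_iff_fg_span_finset_subset (R := S) (N : Set S)).1
    (IsNoetherian.noetherian _)
  let P : Submodule R S := Submodule.span R (T : Set S)
  have hPN : P ≤ N := Submodule.span_le.2 hTN
  -- Since `L ⊆ R`, each `L s` lies in the `R`-span `P` of `T`. Hence `(b s) ↦ ∑ b s * s` descends
  -- to a map from a finite power of `S / L` whose range contains `N / P`.
  have hmul : ∀ s : T, L ≤ P.comap ((LinearMap.toSpanSingleton S S (s : S)).restrictScalars R) :=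
    fun s l hl => P.smul_mem ⟨l, hL l hl⟩ (Submodule.subset_span s.2)
  let ψ : (T → S ⧸ L) →ₗ[R] S ⧸ P :=
    ∑ s : T, (L.mapQ P _ (hmul s)).comp (LinearMap.proj s)
  have hrange : N.map P.mkQ ≤ LinearMap.range ψ := by
    rintro _ ⟨x, hx, rfl⟩
    have hx' : x ∈ Submodule.span S (T : Set S) := hT ▸ Submodule.subset_span hx
    obtain ⟨b, rfl⟩ := Submodule.mem_span_finset'.1 hx'
    refine ⟨fun s => L.mkQ (b s), ?_⟩
    simp [ψ, LinearMap.sum_apply]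
  refine Submodule.fg_of_fg_map_of_fg_inf_ker P.mkQ ?_ ?_
  · exact isNoetherian_submodule.1 (inferInstance : IsNoetherian R (LinearMap.range ψ)) _ hrange
  · rw [Submodule.ker_mkQ, inf_eq_right.2 hPN]
    exact ⟨T, rfl⟩

/-! ### Coefficient description of `IB` -/

section SkewGroupRing

variable {A G : Type*} [CommRing A]

/-- The coefficient at `g` as an additive map. -/
noncomputable def coeffHom (g : G) : SkewMonoidAlgebra A G →+ A :=
  (Finsupp.applyAddHom g).comp SkewMonoidAlgebra.coeffAddEquiv.toAddMonoidHom

theorem coeffHom_apply (g : G) (f : SkewMonoidAlgebra A G) : coeffHom g f = f.coeff g := rfl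

theorem single_mem_of_mem {S : Type*} [SetLike S (SkewMonoidAlgebra A G)]
    [AddSubmonoidClass S (SkewMonoidAlgebra A G)] {W : S} {f : SkewMonoidAlgebra A G}
    (h : ∀ g, SkewMonoidAlgebra.single g (f.coeff g) ∈ W) : f ∈ W := by
  rw [← SkewMonoidAlgebra.sum_single f, SkewMonoidAlgebra.sum_def']
  exact sum_mem fun g _ => h g

variable [Group G] [MulSemiringAction G A]

theorem mem_extendedRightIdeal {I : Ideal A} {b : SkewMonoidAlgebra A G} :
    b ∈ extendedRightIdeal G I ↔ ∀ g, b.coeff g ∈ I := by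
  classical
  constructor
  · intro hb
    induction hb using Submodule.span_induction with
    | mem x hx =>
      obtain ⟨r, hr, rfl⟩ := hx
      intro g
      rw [SkewMonoidAlgebra.coeff_single_apply]
      split_ifs
      exacts [hr, I.zero_mem]
    | zero => exact fun g => I.zero_mem
    | add x y _ _ hx hy =>
      intro g
      rw [SkewMonoidAlgebra.coeff_add, Finsupp.add_apply]
      exact I.add_mem (hx g) (hy g)
    | smul a x _ hx =>
      induction a with | h c => ?_
      intro g
      change (x * c).coeff g ∈ I
      rw [← coeffHom_apply, ← SkewMonoidAlgebra.sum_single c, SkewMonoidAlgebra.sum_def',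
        Finset.mul_sum, map_sum]
      refine I.sum_mem fun h _ => ?_
      rw [coeffHom_apply, coeff_mul_single]
      exact I.mul_mem_right _ (hx _)
  · intro hb
    refine single_mem_of_mem fun g => ?_
    have := mul_mem_right (J := extendedRightIdeal G I)
      (Submodule.subset_span ⟨_, hb g, rfl⟩) (SkewMonoidAlgebra.single g 1)
    simpa [SkewMonoidAlgebra.single_mul_single] using this

theorem mem_idealiser_of_coeff_mem {I : Ideal A} {b : SkewMonoidAlgebra A G}
    (hb : ∀ g ≠ 1, b.coeff g ∈ I) : b ∈ idealiser (extendedRightIdeal G I) := by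
  intro x hx
  induction hx using Submodule.span_induction with
  | mem x hx =>
    obtain ⟨r, hr, rfl⟩ := hx
    rw [mem_extendedRightIdeal]
    intro g
    rw [coeff_mul_single, inv_one, mul_one]
    by_cases hg : g = 1
    · rw [hg, one_smul]
      exact I.mul_mem_left _ hr
    · exact I.mul_mem_right _ (hb g hg)
  | zero => rw [mul_zero]; exact Submodule.zero_mem _
  | add x y _ _ hx hy => rw [mul_add]; exact Submodule.add_mem _ hx hy
  | smul a x _ hx =>
    induction a with | h c => ?_
    change b * (x * c) ∈ _
    rw [← mul_assoc]
    exact mul_mem_right hx c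

end SkewGroupRing

/-! ### Evaluation along the orbit and the elements of the idealiser -/

/-- Translations as a homomorphism from the additive group of the plane. -/
noncomputable def shiftMonoidHom : Multiplicative (ℂ × ℂ) →* (Poly ≃ₐ[ℂ] Poly) where
  toFun g := shift g.toAdd.1 g.toAdd.2
  map_one' := AlgEquiv.ext fun f => DFunLike.congr_fun shiftHom_zero f
  map_mul' _ _ := AlgEquiv.ext fun f => (DFunLike.congr_fun (shiftHom_comp _ _ _ _) f).symm

theorem lattice_smul_eq (g : Lattice) (f : Poly) :
    g • f = shiftHom g.toAdd.1 g.toAdd.2 f := by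
  have h1 : sigma = shiftMonoidHom (Multiplicative.ofAdd (1, 0)) := rfl
  have h2 : tau = shiftMonoidHom (Multiplicative.ofAdd (0, 1)) := rfl
  rw [lattice_smul_def, h1, h2, ← map_zpow shiftMonoidHom, ← map_zpow shiftMonoidHom,
    ← map_mul]
  change shiftHom _ _ f = _
  simp

theorem eval_lattice_smul (p : Fin 2 → ℂ) (g : Lattice) (f : Poly) :
    MvPolynomial.eval p (g • f) = MvPolynomial.eval (translatePoint g.toAdd p) f := by
  have h : (MvPolynomial.aeval p).comp (shiftHom g.toAdd.1 g.toAdd.2) =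
      (MvPolynomial.aeval (translatePoint g.toAdd p) : Poly →ₐ[ℂ] ℂ) := by
    apply MvPolynomial.algHom_ext
    intro i
    fin_cases i <;> simp [shiftHom, translatePoint]
  rw [lattice_smul_eq]
  simpa [MvPolynomial.aeval_eq_eval] using DFunLike.congr_fun h f

theorem translatePoint_injective (p : Fin 2 → ℂ) :
    Function.Injective fun g => translatePoint g p := by
  rintro ⟨a, b⟩ ⟨c, d⟩ h
  have h0 := congr_fun h 0
  have h1 := congr_fun h 1
  simp only [translatePoint, Matrix.cons_val_zero, Matrix.cons_val_one, add_right_inj,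
    Int.cast_inj] at h0 h1
  rw [h0, h1]

theorem exists_eval_eq_one {n k : Type*} [Field k] (T : Finset (n → k)) {q : n → k}
    (hq : q ∉ T) : ∃ r : MvPolynomial n k,
      MvPolynomial.eval q r = 1 ∧ ∀ t ∈ T, MvPolynomial.eval t r = 0 := by
  have h : ∀ t, ∃ l : MvPolynomial n k, t ∈ T →
      MvPolynomial.eval q l = 1 ∧ MvPolynomial.eval t l = 0 := by
    intro t
    by_cases ht : t ∈ T
    · obtain ⟨i, hi⟩ := Function.ne_iff.1 (ne_of_mem_of_not_mem ht hq).symm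
      refine ⟨MvPolynomial.C (q i - t i)⁻¹ * (MvPolynomial.X i - MvPolynomial.C (t i)), fun _ => ?_⟩
      simp [inv_mul_cancel₀ (sub_ne_zero.2 hi)]
    · exact ⟨0, fun h => absurd h ht⟩
  choose l hl using h
  refine ⟨∏ t ∈ T, l t, ?_, fun t ht => ?_⟩
  · rw [map_prod]
    exact Finset.prod_eq_one fun t ht => (hl t ht).1
  · rw [map_prod]
    exact Finset.prod_eq_zero ht (hl t ht).2

/-- The polynomials vanishing at `p`. -/
noncomputable abbrev pointIdeal (p : Fin 2 → ℂ) : Ideal Poly := MvPolynomial.vanishingIdeal ℂ {p}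

theorem mem_pointIdeal {p : Fin 2 → ℂ} {f : Poly} :
    f ∈ pointIdeal p ↔ MvPolynomial.eval p f = 0 := by
  rw [MvPolynomial.mem_vanishingIdeal_singleton_iff, MvPolynomial.aeval_eq_eval]

/-- For `g` in a finite set of lattice points, a polynomial with prescribed value at `p + g`
vanishing at the other translates. -/
theorem exists_eval_translate (p : Fin 2 → ℂ) (T : Finset Lattice) (g : Lattice) (v : ℂ) :
    ∃ r : Poly, MvPolynomial.eval p (g • r) = v ∧
      ∀ h ∈ T, h ≠ g → MvPolynomial.eval p (h • r) = 0 := by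
  classical
  obtain ⟨r, hr, hrT⟩ := exists_eval_eq_one
    ((T.erase g).image fun h => translatePoint h.toAdd p) (q := translatePoint g.toAdd p) (by
      simp only [Finset.mem_image, Finset.mem_erase, not_exists, not_and]
      rintro h ⟨hne, -⟩ heq
      exact hne (Multiplicative.toAdd.injective (translatePoint_injective p heq)))
  refine ⟨MvPolynomial.C v * r, ?_, fun h hh hne => ?_⟩
  · rw [eval_lattice_smul, map_mul, hr, MvPolynomial.eval_C, mul_one]
  · rw [eval_lattice_smul, map_mul, hrT _ (Finset.mem_image_of_mem _ (Finset.mem_erase.2 ⟨hne, hh⟩)),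
      mul_zero]

/-- For `g ≠ 1` some `r ∈ I` takes the value `1` at the translate of `p` by `g`; the coefficient of
`b * r` at `g` then has the same value at `p` as that of `b`. -/
theorem mem_idealiserAt {p : Fin 2 → ℂ} {b : SkewRing} :
    b ∈ idealiserAt (pointIdeal p) ↔ ∀ g ≠ 1, b.coeff g ∈ pointIdeal p := by
  refine ⟨fun hb g hg => ?_, mem_idealiser_of_coeff_mem⟩
  obtain ⟨r, hr, hr1⟩ := exists_eval_translate p {1} g 1
  have hrI : r ∈ pointIdeal p := by
    simpa [mem_pointIdeal] using hr1 1 (Finset.mem_singleton_self _) hg.symm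
  have h := mem_extendedRightIdeal.1 (hb _ (Submodule.subset_span ⟨r, hrI, rfl⟩)) g
  rw [coeff_mul_single, inv_one, mul_one, mem_pointIdeal, map_mul, hr, mul_one] at h
  exact mem_pointIdeal.2 h

/-! ### The quotient `B / IB` over the idealiser -/

theorem mem_idealiserAt_of_mem {p : Fin 2 → ℂ} {b : SkewRing}
    (hb : b ∈ extendedRightIdeal Lattice (pointIdeal p)) : b ∈ idealiserAt (pointIdeal p) :=
  mem_idealiserAt.2 fun g _ => mem_extendedRightIdeal.1 hb g

/-- If `b` is not in the idealiser `R` of `I B`, then `b R + I B = B`. -/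
theorem exists_mul_sub_single_mem {p : Fin 2 → ℂ} {b : SkewRing}
    (hb : b ∉ idealiserAt (pointIdeal p)) (h : Lattice) (c : Poly) :
    ∃ r ∈ idealiserAt (pointIdeal p),
      SkewMonoidAlgebra.single h c - b * r ∈ extendedRightIdeal Lattice (pointIdeal p) := by
  classical
  rw [mem_idealiserAt] at hb
  push Not at hb
  obtain ⟨g, hg1, hg⟩ := hb
  rw [mem_pointIdeal] at hg
  -- Interpolation isolates the term of `b` at `g`: modulo `IB` it alone survives, rescaled to match
  -- `c` at `p`. Including `1` in the finite set puts `r` in `I`.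
  obtain ⟨r, hr, hrT⟩ := exists_eval_translate p (insert 1 b.support) g
    (MvPolynomial.eval p c / MvPolynomial.eval p (b.coeff g))
  have hrI : r ∈ pointIdeal p := by
    simpa [mem_pointIdeal] using hrT 1 (Finset.mem_insert_self _ _) hg1.symm
  refine ⟨SkewMonoidAlgebra.single (g⁻¹ * h) r, mem_idealiserAt_of_mem ?_, ?_⟩
  · rw [mem_extendedRightIdeal]
    intro z
    rw [SkewMonoidAlgebra.coeff_single_apply]
    split_ifs
    exacts [hrI, Ideal.zero_mem _]
  · rw [mem_extendedRightIdeal]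
    intro z
    rw [SkewMonoidAlgebra.coeff_sub, Finsupp.sub_apply, coeff_mul_single,
      SkewMonoidAlgebra.coeff_single_apply, mem_pointIdeal, map_sub, map_mul]
    split_ifs with hz
    · subst hz
      rw [mul_inv_rev, inv_inv, mul_inv_cancel_left, hr, mul_div_cancel₀ _ hg, sub_self]
    · rw [map_zero, zero_sub, neg_eq_zero]
      set k := z * (g⁻¹ * h)⁻¹ with hk
      by_cases hkb : k ∈ b.support
      · rw [hrT k (Finset.mem_insert_of_mem hkb), mul_zero]
        intro hkg
        rw [hk, mul_inv_eq_iff_eq_mul, mul_inv_cancel_left] at hkg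
        exact hz hkg.symm
      · rw [SkewMonoidAlgebra.notMem_support_iff.1 hkb, map_zero, zero_mul]

/-- If `b` is in the idealiser `R` of `I B` but not in `I B`, then `b R + I B ⊇ R`. -/
theorem exists_mul_sub_mem {p : Fin 2 → ℂ} {b x : SkewRing}
    (hb : b ∈ idealiserAt (pointIdeal p))
    (hb' : b ∉ extendedRightIdeal Lattice (pointIdeal p))
    (hx : x ∈ idealiserAt (pointIdeal p)) :
    ∃ r ∈ idealiserAt (pointIdeal p),
      x - b * r ∈ extendedRightIdeal Lattice (pointIdeal p) := by
  classical
  rw [mem_idealiserAt] at hb hx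
  have h1 : MvPolynomial.eval p (b.coeff 1) ≠ 0 := by
    intro h
    refine hb' (mem_extendedRightIdeal.2 fun g => ?_)
    by_cases hg : g = 1
    · rw [hg]
      exact mem_pointIdeal.2 h
    · exact hb g hg
  refine ⟨SkewMonoidAlgebra.single 1 (MvPolynomial.C
    (MvPolynomial.eval p (x.coeff 1) / MvPolynomial.eval p (b.coeff 1))), ?_, ?_⟩
  · rw [mem_idealiserAt]
    intro g hg
    rw [SkewMonoidAlgebra.coeff_single_apply, if_neg hg.symm]
    exact Ideal.zero_mem _
  · rw [mem_extendedRightIdeal]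
    intro g
    rw [SkewMonoidAlgebra.coeff_sub, Finsupp.sub_apply, coeff_mul_single, inv_one, mul_one]
    by_cases hg : g = 1
    · rw [hg, one_smul, mem_pointIdeal, map_sub, map_mul, MvPolynomial.eval_C,
        mul_div_cancel₀ _ h1, sub_self]
    · exact Ideal.sub_mem _ (hx g hg) (Ideal.mul_mem_right _ _ (hb g hg))

/-- The right ideal `I B` as a module over the opposite of its idealiser. -/
def oppositeIdeal (p : Fin 2 → ℂ) : Submodule (idealiserAt (pointIdeal p)).op SkewRingᵐᵒᵖ where
  carrier := {b | b.unop ∈ extendedRightIdeal Lattice (pointIdeal p)}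
  zero_mem' := (extendedRightIdeal Lattice (pointIdeal p)).zero_mem
  add_mem' := fun ha hb => (extendedRightIdeal Lattice (pointIdeal p)).add_mem ha hb
  smul_mem' := fun r b hb =>
    show b.unop * r.1.unop ∈ extendedRightIdeal Lattice (pointIdeal p) from mul_mem_right hb _

theorem mk_mem_span_of_sub_mem {p : Fin 2 → ℂ} {b x r : SkewRing}
    (hr : r ∈ idealiserAt (pointIdeal p))
    (h : x - b * r ∈ extendedRightIdeal Lattice (pointIdeal p)) :
    (oppositeIdeal p).mkQ (.op x) ∈
      Submodule.span (idealiserAt (pointIdeal p)).op {(oppositeIdeal p).mkQ (.op b)} := by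
  rw [Submodule.mem_span_singleton]
  refine ⟨⟨.op r, hr⟩, ?_⟩
  rw [← map_smul, eq_comm, ← sub_eq_zero, ← map_sub, Submodule.mkQ_apply,
    Submodule.Quotient.mk_eq_zero]
  exact h

/-- Every submodule is cyclic: an element outside the idealiser generates everything, and otherwise
any nonzero element generates `R / IB`. -/
theorem isNoetherian_quotient_oppositeIdeal (p : Fin 2 → ℂ) :
    IsNoetherian (idealiserAt (pointIdeal p)).op (SkewRingᵐᵒᵖ ⧸ oppositeIdeal p) := by
  refine ⟨fun N => ?_⟩
  suffices ∃ v, N = Submodule.span _ {v} by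
    obtain ⟨v, rfl⟩ := this
    exact Submodule.fg_span_singleton v
  by_cases hN : ∃ b : SkewRing, (oppositeIdeal p).mkQ (.op b) ∈ N ∧
      b ∉ idealiserAt (pointIdeal p)
  · obtain ⟨b, hbN, hb⟩ := hN
    refine ⟨(oppositeIdeal p).mkQ (.op b), le_antisymm (fun y _ => ?_)
      ((Submodule.span_singleton_le_iff_mem _ _).2 hbN)⟩
    obtain ⟨⟨x⟩, rfl⟩ := (oppositeIdeal p).mkQ_surjective y
    -- The condition is additive in `x`, so checking single terms suffices.
    change x ∈ ((Submodule.span _ {(oppositeIdeal p).mkQ (.op b)}).comap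
      (oppositeIdeal p).mkQ).toAddSubmonoid.comap MulOpposite.opAddEquiv.toAddMonoidHom
    refine single_mem_of_mem fun h => ?_
    obtain ⟨r, hr, hrM⟩ := exists_mul_sub_single_mem hb h (x.coeff h)
    exact mk_mem_span_of_sub_mem hr hrM
  · push Not at hN
    by_cases hbot : N = ⊥
    · exact ⟨0, by rw [hbot, Submodule.span_zero_singleton]⟩
    obtain ⟨y, hy, hy0⟩ := N.ne_bot_iff.1 hbot
    obtain ⟨⟨b⟩, rfl⟩ := (oppositeIdeal p).mkQ_surjective y
    have hb' : b ∉ extendedRightIdeal Lattice (pointIdeal p) := fun h =>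
      hy0 ((Submodule.Quotient.mk_eq_zero _).2 h)
    refine ⟨(oppositeIdeal p).mkQ (.op b), le_antisymm (fun y hyN => ?_)
      ((Submodule.span_singleton_le_iff_mem _ _).2 hy)⟩
    obtain ⟨⟨x⟩, rfl⟩ := (oppositeIdeal p).mkQ_surjective y
    obtain ⟨r, hr, hrM⟩ := exists_mul_sub_mem (hN b hy) hb' (hN x hyN)
    exact mk_mem_span_of_sub_mem hr hrM

theorem isNoetherian_idealiserAt (p : Fin 2 → ℂ) :
    IsNoetherian (idealiserAt (pointIdeal p))ᵐᵒᵖ (idealiserAt (pointIdeal p)) := by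
  have : IsNoetherian SkewRingᵐᵒᵖ SkewRing := isNoetherian_skewMonoidAlgebra
  have : IsNoetherianRing SkewRingᵐᵒᵖ :=
    isNoetherian_of_linearEquiv (MulOpposite.opLinearEquiv SkewRingᵐᵒᵖ)
  have := isNoetherian_quotient_oppositeIdeal p
  have h := isNoetherianRing_of_quotient _ (oppositeIdeal p) fun l hl => mem_idealiserAt_of_mem hl
  have : IsNoetherianRing (idealiserAt (pointIdeal p))ᵐᵒᵖ :=
    isNoetherianRing_of_ringEquiv _ (Subring.mopRingEquivOp _).symm
  exact isNoetherian_of_linearEquiv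
    (MulOpposite.opLinearEquiv (idealiserAt (pointIdeal p))ᵐᵒᵖ).symm

/-! ### Failure of the left noetherian property -/

theorem not_isNoetherian_idealiserAt (p : Fin 2 → ℂ) :
    ¬ IsNoetherian (idealiserAt (pointIdeal p)) (idealiserAt (pointIdeal p)) := by
  intro hR
  let f : Poly := MvPolynomial.X 0 - MvPolynomial.C (p 0)
  have hf : f ∈ pointIdeal p := by simp [f]
  have hf0 : f ≠ 0 := fun h => by
    have := congr_arg (MvPolynomial.eval (translatePoint (1, 0) p)) h
    simp [f, translatePoint] at this
  let e : ℤ → Lattice := fun j => .ofAdd (0, j)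
  have he : Function.Injective e := fun i j h => congr_arg Prod.snd (Multiplicative.ofAdd.injective h)
  have hef : ∀ i j, (e j * (e i)⁻¹) • f = f := fun i j => by
    rw [lattice_smul_eq]
    simp [f, e, shiftHom, MvPolynomial.algHom_C]
  let v : ℤ → idealiserAt (pointIdeal p) := fun j =>
    ⟨SkewMonoidAlgebra.single (e j) f, mem_idealiserAt_of_mem <| by
      classical
      rw [mem_extendedRightIdeal]
      intro z
      rw [SkewMonoidAlgebra.coeff_single_apply]
      split_ifs
      exacts [hf, Ideal.zero_mem _]⟩
  have hv : Function.Injective v := fun i j h =>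
    he ((SkewMonoidAlgebra.single_left_inj hf0).1 (congr_arg Subtype.val h))
  obtain ⟨T, hTv, hT⟩ := (Submodule.fg_span_iff_fg_span_finset_subset
    (R := idealiserAt (pointIdeal p)) (Set.range v)).1 (IsNoetherian.noetherian _)
  obtain ⟨_, ⟨j, rfl⟩, hj⟩ := (Set.infinite_range_of_injective hv).exists_notMem_finset T
  obtain ⟨c, hc⟩ := Submodule.mem_span_finset'.1
    (hT ▸ Submodule.subset_span (Set.mem_range_self j) : v j ∈ Submodule.span _ (T : Set _))
  have hc' : coeffHom (e j) (∑ t : T, (c t : SkewRing) * (t.1 : SkewRing)) = f := by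
    have h := congr_arg (fun x : idealiserAt (pointIdeal p) => coeffHom (e j) (x : SkewRing)) hc
    simp only [AddSubmonoidClass.coe_finsetSum, smul_eq_mul, Subring.coe_mul] at h
    rw [h]
    simp [v, coeffHom_apply]
  -- Each generator in `T` sits at some `e i` with `i ≠ j`, so it meets a coefficient of `c t` away
  -- from the identity, which lies in the ideal of `p`.
  have hmem : f ∈ pointIdeal p * Ideal.span {f} := by
    suffices h : coeffHom (e j) (∑ t : T, (c t : SkewRing) * (t.1 : SkewRing)) ∈
        pointIdeal p * Ideal.span {f} by rwa [hc'] at h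
    rw [map_sum]
    refine Ideal.sum_mem _ fun t _ => ?_
    obtain ⟨i, hi⟩ := hTv t.2
    have hij : i ≠ j := by
      rintro rfl
      exact hj (hi ▸ t.2)
    rw [← hi, coeffHom_apply, coeff_mul_single, hef]
    refine Ideal.mul_mem_mul (mem_idealiserAt.1 (c t).2 _ fun h => hij ?_)
      (Ideal.mem_span_singleton_self f)
    exact (he (mul_inv_eq_one.1 h)).symm
  obtain ⟨z, hz, hzf⟩ := Ideal.mem_mul_span_singleton.1 hmem
  have hz1 : z = 1 := mul_right_cancel₀ hf0 (hzf.trans (one_mul f).symm)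
  simp [hz1] at hz

/-! ### The orbit and the vertical line -/

theorem zeroLocus_pointIdeal (p : Fin 2 → ℂ) :
    MvPolynomial.zeroLocus ℂ (pointIdeal p) = {p} := by
  refine Set.Subset.antisymm (fun q hq => ?_) (MvPolynomial.zeroLocus_vanishingIdeal_le _)
  by_contra h
  obtain ⟨s, hs, hsq⟩ := exists_eval_eq_one {p} (q := q) (by simpa using h)
  have := hq s (mem_pointIdeal.2 (hsq p (Finset.mem_singleton_self p)))
  simp [MvPolynomial.aeval_eq_eval, hs] at this

theorem mem_verticalLine {c : ℂ} {q : Fin 2 → ℂ} : q ∈ verticalLine c ↔ q 0 = c := by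
  simp [verticalLine, MvPolynomial.zeroLocus_span, sub_eq_zero]

theorem translatePoint_mem_verticalLine (p : Fin 2 → ℂ) (j : ℤ) :
    translatePoint (0, j) p ∈ verticalLine (p 0) := by
  simp [mem_verticalLine, translatePoint]

theorem infinite_pointOrbit_inter_verticalLine (p : Fin 2 → ℂ) :
    (pointOrbit p ∩ verticalLine (p 0)).Infinite := by
  have hinj : Function.Injective fun j : ℤ => translatePoint (0, j) p :=
    (translatePoint_injective p).comp (Prod.mk_right_injective 0)
  refine (Set.infinite_range_of_injective hinj).mono ?_
  rintro _ ⟨j, rfl⟩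
  exact ⟨⟨(0, j), rfl⟩, translatePoint_mem_verticalLine p j⟩

theorem not_isCriticallyDense_pointOrbit (p : Fin 2 → ℂ) :
    ¬ IsCriticallyDense Set.univ (pointOrbit p) := by
  rintro ⟨-, -, h⟩
  refine infinite_pointOrbit_inter_verticalLine p ?_
  -- The line is a proper closed subset because it misses the translate of `p` by `(1, 0)`.
  have := h (Ideal.span {MvPolynomial.X 0 - MvPolynomial.C (p 0)}) fun hle => by
    have h1 : translatePoint (1, 0) p ∈ verticalLine (p 0) := hle (Set.mem_univ _)
    simp [mem_verticalLine, translatePoint] at h1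
  rwa [Set.univ_inter] at this

end IdealiserExample

theorem mainTheorem12 (I : Ideal IdealiserExample.Poly) (hI : I.IsMaximal) :
    (IsNoetherian (IdealiserExample.idealiserAt I)ᵐᵒᵖ (IdealiserExample.idealiserAt I) ∧
      ¬ IsNoetherian (IdealiserExample.idealiserAt I) (IdealiserExample.idealiserAt I)) ∧
    ∃ p : Fin 2 → ℂ, MvPolynomial.zeroLocus ℂ I = {p} ∧
      (∀ j : ℤ, IdealiserExample.translatePoint (0, j) p ∈ IdealiserExample.verticalLine (p 0)) ∧
      (IdealiserExample.pointOrbit p ∩ IdealiserExample.verticalLine (p 0)).Infinite ∧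
      ¬ IdealiserExample.IsCriticallyDense Set.univ (IdealiserExample.pointOrbit p) := by
  obtain ⟨p, rfl⟩ := MvPolynomial.isMaximal_iff_eq_vanishingIdeal_singleton.1 hI
  open IdealiserExample in
  exact ⟨⟨isNoetherian_idealiserAt p, not_isNoetherian_idealiserAt p⟩, p, zeroLocus_pointIdeal p,
    translatePoint_mem_verticalLine p, infinite_pointOrbit_inter_verticalLine p,
    not_isCriticallyDense_pointOrbit p⟩
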